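/- Let the Fibonacci polynomials be defined by $F_0(x)=0$, $F_1(x)=1$, $F_m(x)=xF_{m-1}(x)+F_{m-2}(x)$ for $m\ge 2$. Let $q$ be a positive even integer, $m=2+12q$, and $u=u_1(q)=\min\{i\ge 1: c_i=1\}$, where $q=\sum_i c_i2^i$ with $c_i\in\{0,1\}$ is the binary expansion of $q$. Recall that the minimal decomposition of $\mathbb{Z}_2$ for a polynomial $f$ over $\mathbb{Z}_2$ is the partition $\mathbb{Z}_2=\mathcal P\sqcup\mathcal M\sqcup\mathcal B$, where $\mathcal P$ is the finite set of all periodic points of $f$; $\mathcal M=\bigsqcup_i\mathcal M_i$ is the union of all (at most countably many, pairwise disjoint) minimal components, that is, nonempty clopen sets $\mathcal M_i$ with $f(\mathcal M_i)\subseteq\mathcal M_i$ which are finite unions of balls $a+2^l\mathbb{Z}_2$ and on which $f:\mathcal M_i\to\mathcal M_i$ is minimal (every orbit is dense in $\mathcal M_i$); and every point of $\mathcal B$ lies in the attracting basin of a periodic orbit or of a minimal component. Then the minimal decomposition of $\mathbb{Z}_2$ for $F_m$ is $$\mathbb{Z}_2=\{0\}\sqcup\Bigl(\bigsqcup_{k=0}^{2^{u+2}-1}A_k\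 \sqcup\ \bigsqcup_{n\ge 1}\bigsqcup_{k=0}^{2^u-1}M_{n,k}\Bigr),$$ where $A_k=1+2k+2^{u+3}\mathbb{Z}_2$ and $M_{n,k}=(1+2k)2^n+2^{n+u+1}\mathbb{Z}_2$. Here $0$ is a fixed point of $F_m$ and the only periodic point, the sets $A_k$ and $M_{n,k}$ are pairwise disjoint and are exactly the minimal components, and $\mathcal B=\emptyset$. -/

import Mathlib

open Polynomial

/-- The Fibonacci polynomials `F_0 = 0`, `F_1 = 1`, `F_m = x F_{m-1} + F_{m-2}`. -/
noncomputable def fibPoly (R : Type*) [CommRing R] : ℕ → R[X]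
  | 0 => 0
  | 1 => 1
  | (m + 2) => X * fibPoly R (m + 1) + fibPoly R m

/-- `u_1(q) = min {i ≥ 1 | c_i = 1}`, where `q = ∑ c_i 2^i` is the binary expansion of `q`. -/
noncomputable def u₁ (q : ℕ) : ℕ := sInf {i : ℕ | 1 ≤ i ∧ q.testBit i = true}

/-- The ball `a + p^l ℤ_p`. -/
def padicBall (p : ℕ) [Fact p.Prime] (a : ℤ_[p]) (l : ℕ) : Set ℤ_[p] :=
  {x | ∃ z : ℤ_[p], x = a + (p : ℤ_[p]) ^ l * z}

/-- `S` is nonempty, invariant under `f`, and the subsystem `f : S → S` is minimal: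
the orbit of every point of `S` is dense in `S`. -/
def IsMinimalOn {α : Type*} [TopologicalSpace α] (f : α → α) (S : Set α) : Prop :=
  S.Nonempty ∧ Set.MapsTo f S S ∧ ∀ x ∈ S, S ⊆ closure (Set.range fun n : ℕ => f^[n] x)

/-- The attracting basin of a set `Y`: the points whose orbits converge to `Y`. -/
def attractingBasin {α : Type*} [PseudoMetricSpace α] (f : α → α) (Y : Set α) : Set α :=
  {x | Filter.Tendsto (fun n : ℕ => Metric.infDist (f^[n] x) Y) Filter.atTop (nhds 0)}

/-- A clopen invariant set that is a finite union of balls, on which `f` is minimal. -/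
structure IsMinimalComponent {p : ℕ} [Fact p.Prime] (f : ℤ_[p] → ℤ_[p])
    (S : Set ℤ_[p]) : Prop where
  isClopen : IsClopen S
  finite_union_balls : ∃ T : Finset (ℤ_[p] × ℕ), S = ⋃ b ∈ T, padicBall p b.1 b.2
  isMinimalOn : IsMinimalOn f S

/-- `ℤ_p = P ⊔ (⊔ i, M i) ⊔ B` is the minimal decomposition of the polynomial `f`: `P` is the
finite set of all periodic points, the `M i` are all the minimal components (countably many,
pairwise disjoint, listed without repetition), and every point of `B` lies in the attracting basin
of a periodic orbit or of a minimal component. -/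
structure IsMinimalDecomposition {p : ℕ} [Fact p.Prime] (f : ℤ_[p][X]) {ι : Type*}
    (P : Set ℤ_[p]) (M : ι → Set ℤ_[p]) (B : Set ℤ_[p]) : Prop where
  cover : P ∪ (⋃ i, M i) ∪ B = Set.univ
  disjoint_periodic_minimal : Disjoint P (⋃ i, M i)
  disjoint_periodic_basin : Disjoint P B
  disjoint_minimal_basin : Disjoint (⋃ i, M i) B
  periodic_finite : P.Finite
  periodic_eq : P = Function.periodicPts (fun x => f.eval x)
  countable : Countable ι
  pairwise_disjoint : Pairwise (Function.onFun Disjoint M)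
  minimal : ∀ i, IsMinimalComponent (fun x => f.eval x) (M i)
  minimal_all : ∀ S, IsMinimalComponent (fun x => f.eval x) S → ∃ i, S = M i
  basin : ∀ x ∈ B,
    (∃ y ∈ P, x ∈ attractingBasin (fun x => f.eval x)
      (Set.range fun n : ℕ => (fun x => f.eval x)^[n] y)) ∨
    (∃ i, x ∈ attractingBasin (fun x => f.eval x) (M i))

/-! ### Fibonacci polynomials: addition law, Cassini identity, growth of 2-divisibility. -/

section FibonacciPolynomials

variable {R : Type*} [CommRing R]

/-! Write f = F_m and n = 6q. Cassini gives F_m - X = F_n · ((X² + 2)F_{n+1} + X F_n), so the 2-adic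
size of f(x) - x follows from that of F_6(x) = x(x² + 1)(x² + 3): each doubling of the index
contributes exactly one factor 2, an odd multiple none. As u is the valuation of q, f(x) - x is
2^(u+3) · odd for odd x and x · 2^(u+1) · odd for even x; these exponents fix the radii of A_k and
M_{n,k}.

Since F_12 ∣ F_{6q}, also f(x) - f(y) = (x - y)(1 + 4t) whenever x ≡ y mod 2. On a ball of radius
exponent l where f(x) - x = 2^l · odd, this gives f^[2^n](x) - x = 2^(l+n) · odd, so orbits meet
every residue class and f is minimal there (`isMinimalOn_padicBall`). The balls partition the
nonzero 2-adic integers, leaving only the fixed point 0. -/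

theorem fibPoly_add_two (n : ℕ) :
    fibPoly R (n + 2) = X * fibPoly R (n + 1) + fibPoly R n := by
  rw [fibPoly]

theorem fibPoly_add (a b : ℕ) : fibPoly R (a + b + 1) =
    fibPoly R (a + 1) * fibPoly R (b + 1) + fibPoly R a * fibPoly R b := by
  induction b generalizing a with
  | zero => simp [fibPoly]
  | succ b ih =>
    have h := ih (a + 1)
    rw [show a + 1 + b + 1 = a + (b + 1) + 1 by ring] at h
    rw [h, fibPoly_add_two, fibPoly_add_two]
    ring

theorem fibPoly_cassini (n : ℕ) :
    fibPoly R (n + 1) ^ 2 - X * fibPoly R (n + 1) * fibPoly R n - fibPoly R n ^ 2 = (-1) ^ n := by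
  induction n with
  | zero => simp [fibPoly]
  | succ n ih =>
    rw [fibPoly_add_two, pow_succ (-1 : R[X]), ← ih]
    ring

theorem fibPoly_add' (a b : ℕ) : fibPoly R (a + b) =
    fibPoly R (a + 1) * fibPoly R b + fibPoly R a * (fibPoly R (b + 1) - X * fibPoly R b) := by
  cases b with
  | zero => simp [fibPoly]
  | succ b =>
    rw [← add_assoc, fibPoly_add, fibPoly_add_two]
    ring

theorem fibPoly_dvd_mul (n k : ℕ) : fibPoly R n ∣ fibPoly R (n * k) := by
  induction k with
  | zero => simp [fibPoly]
  | succ k ih =>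
    rw [mul_add_one, fibPoly_add']
    exact dvd_add (Dvd.intro_left _ rfl) (ih.mul_right _)

theorem fibPoly_two_mul_add_two_sub {n : ℕ} (hn : Even n) : fibPoly R (2 * n + 2) - X =
    fibPoly R n * ((X ^ 2 + 2) * fibPoly R (n + 1) + X * fibPoly R n) := by
  have h := fibPoly_cassini (R := R) n
  rw [hn.neg_one_pow] at h
  rw [fibPoly_add_two, two_mul, fibPoly_add n n, fibPoly_add' n n]
  linear_combination X * h

theorem fibPoly_six : fibPoly R 6 = X ^ 5 + 4 * X ^ 3 + 3 * X := by
  simp only [fibPoly]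
  ring

theorem fibPoly_twelve : fibPoly R 12 =
    (X ^ 5 + 4 * X ^ 3 + 3 * X) * (X ^ 6 + 6 * X ^ 4 + 9 * X ^ 2 + 2) := by
  simp only [fibPoly]
  ring

/-- The quotient F_{ns}/F_n changes parity each time s grows by 1, so it is ≡ s mod 2; the induction
carries this as `Odd (c + s + 1)`. -/
theorem eval_fibPoly_mul {x : R} {n : ℕ} (h0 : Even ((fibPoly R n).eval x))
    (h1 : Odd ((fibPoly R (n + 1)).eval x)) {s : ℕ} (hs : Odd s) :
    (∃ c, Odd c ∧ (fibPoly R (n * s)).eval x = (fibPoly R n).eval x * c) ∧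
      Odd ((fibPoly R (n * s + 1)).eval x) := by
  have key : ∀ s : ℕ, (∃ c : R, Odd (c + s + 1) ∧
      (fibPoly R (n * s)).eval x = (fibPoly R n).eval x * c) ∧
      Odd ((fibPoly R (n * s + 1)).eval x) := by
    intro s
    induction s with
    | zero => exact ⟨⟨0, by simp, by simp [fibPoly]⟩, by simp [fibPoly]⟩
    | succ s ih =>
      obtain ⟨⟨c, hc, h⟩, ho⟩ := ih
      refine ⟨⟨(fibPoly R (n * s + 1)).eval x +
        c * ((fibPoly R (n + 1)).eval x - x * (fibPoly R n).eval x), ?_, ?_⟩, ?_⟩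
      · obtain ⟨a, ha⟩ := ho
        obtain ⟨b, hb⟩ := h1
        obtain ⟨d, hd⟩ := h0
        obtain ⟨e, he⟩ := hc
        refine ⟨a + c * b - c * x * d + e + 1, ?_⟩
        rw [ha, hb, hd]
        push_cast
        linear_combination he
      · rw [mul_add_one, fibPoly_add']
        simp only [eval_add, eval_mul, eval_sub, eval_X, h]
        ring
      · rw [mul_add_one, fibPoly_add]
        simp only [eval_add, eval_mul]
        exact (ho.mul h1).add_even (h0.mul_left _)
  obtain ⟨⟨c, hc, h⟩, ho⟩ := key s
  refine ⟨⟨c, ?_, h⟩, ho⟩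
  obtain ⟨d, hd⟩ := hc
  obtain ⟨k, rfl⟩ := hs
  refine ⟨d - k - 1, ?_⟩
  push_cast at hd
  linear_combination hd

/-- F_{2N} = F_N (2F_{N+1} - xF_N), and 4 ∣ xF_N makes the bracket twice an odd element. -/
theorem eval_fibPoly_two_pow_mul {x : R} {n : ℕ} (h0 : Even ((fibPoly R n).eval x))
    (h1 : Odd ((fibPoly R (n + 1)).eval x)) (h4 : 4 ∣ x * (fibPoly R n).eval x) (v : ℕ) :
    (∃ c, Odd c ∧ (fibPoly R (n * 2 ^ v)).eval x = 2 ^ v * (fibPoly R n).eval x * c) ∧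
      Odd ((fibPoly R (n * 2 ^ v + 1)).eval x) := by
  induction v with
  | zero => exact ⟨⟨1, by simp, by simp⟩, by simpa using h1⟩
  | succ v ih =>
    obtain ⟨⟨c, hc, h⟩, ho⟩ := ih
    obtain ⟨d, hd⟩ := h4
    rw [pow_succ, ← mul_assoc, mul_two]
    refine ⟨⟨c * ((fibPoly R (n * 2 ^ v + 1)).eval x - 2 ^ v * 2 * d * c), ?_, ?_⟩, ?_⟩
    · refine hc.mul (ho.sub_even ?_)
      exact even_iff_two_dvd.2 ⟨2 ^ v * d * c, by ring⟩
    · rw [fibPoly_add']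
      simp only [eval_add, eval_mul, eval_sub, eval_X, h]
      linear_combination (-2 ^ v * 2 ^ v * c ^ 2 * (fibPoly R n).eval x) * hd
    · rw [fibPoly_add]
      simp only [eval_add, eval_mul]
      refine (ho.mul ho).add_even ?_
      rw [h]
      exact ((h0.mul_left _).mul_right _).mul_right _

end FibonacciPolynomials

/-! ### Parity and odd parts in the 2-adic integers. -/

section PadicParity

theorem PadicInt.two_not_isUnit : ¬ IsUnit (2 : ℤ_[2]) := by
  have := PadicInt.prime_p (p := 2)
  exact_mod_cast this.not_isUnit

theorem PadicInt.even_or_odd (x : ℤ_[2]) : Even x ∨ Odd x := by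
  obtain ⟨n, hn, -⟩ := PadicInt.existsUnique_mem_range x
  obtain ⟨h2, hn⟩ := hn
  rw [PadicInt.maximalIdeal_eq_span_p, Ideal.mem_span_singleton] at hn
  obtain ⟨y, hy⟩ := hn
  push_cast at hy
  interval_cases n
  · exact .inl (even_iff_two_dvd.2 ⟨y, by simpa using hy⟩)
  · exact .inr ⟨y, by push_cast at hy; linear_combination hy⟩

theorem PadicInt.not_odd_of_even {x : ℤ_[2]} (h : Even x) : ¬ Odd x := by
  rintro ⟨a, ha⟩
  obtain ⟨b, hb⟩ := h
  exact PadicInt.two_not_isUnit (IsUnit.of_mul_eq_one (b - a) (by linear_combination ha - hb))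

theorem PadicInt.exists_eq_two_pow_mul_odd {x : ℤ_[2]} (hx : x ≠ 0) :
    ∃ (n : ℕ) (c : ℤ_[2]), Odd c ∧ x = 2 ^ n * c := by
  refine ⟨x.valuation, PadicInt.unitCoeff hx, ?_, ?_⟩
  · refine (PadicInt.even_or_odd _).resolve_left fun h => PadicInt.two_not_isUnit ?_
    exact isUnit_of_dvd_unit (even_iff_two_dvd.1 h) (PadicInt.unitCoeff hx).isUnit
  · have := PadicInt.unitCoeff_spec hx
    push_cast at this
    rw [mul_comm]
    exact this

theorem PadicInt.two_pow_mul_odd_inj {n k : ℕ} {c d : ℤ_[2]} (hc : Odd c) (hd : Odd d)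
    (h : 2 ^ n * c = 2 ^ k * d) : n = k := by
  wlog hnk : n ≤ k generalizing n k c d
  · exact (this hd hc h.symm (by omega)).symm
  obtain ⟨j, rfl⟩ := Nat.exists_eq_add_of_le hnk
  rw [pow_add, mul_assoc] at h
  have h' := mul_left_cancel₀ (pow_ne_zero n two_ne_zero) h
  rcases j with _ | j
  · rfl
  · exact absurd hc (PadicInt.not_odd_of_even
      (even_iff_two_dvd.2 ⟨2 ^ j * d, by rw [h']; ring⟩))

theorem PadicInt.natCast_odd {n : ℕ} (h : Odd (n : ℤ_[2])) : Odd n := by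
  by_contra hn
  exact PadicInt.not_odd_of_even ((Nat.not_odd_iff_even.1 hn).natCast) h

end PadicParity

/-! ### Balls as clopen sets and residue classes. -/

section Balls

theorem mem_padicBall_self {p : ℕ} [Fact p.Prime] (a : ℤ_[p]) (l : ℕ) : a ∈ padicBall p a l :=
  ⟨0, by simp⟩

theorem padicBall_infinite {p : ℕ} [Fact p.Prime] (a : ℤ_[p]) (l : ℕ) :
    (padicBall p a l).Infinite := by
  have hp : (p : ℤ_[p]) ≠ 0 := PadicInt.prime_p.ne_zero
  have : padicBall p a l = Set.range fun z : ℤ_[p] => a + (p : ℤ_[p]) ^ l * z := by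
    ext x
    simp [padicBall, eq_comm]
  rw [this]
  refine Set.infinite_range_of_injective fun z w h => ?_
  exact mul_left_cancel₀ (pow_ne_zero l hp) (add_left_cancel h)

theorem padicBall_eq_closedBall {p : ℕ} [Fact p.Prime] (a : ℤ_[p]) (l : ℕ) :
    padicBall p a l = Metric.closedBall a ((p : ℝ) ^ (-l : ℤ)) := by
  ext x
  rw [Metric.mem_closedBall, dist_eq_norm, PadicInt.norm_le_pow_iff_mem_span_pow,
    Ideal.mem_span_singleton]
  exact ⟨fun ⟨z, hz⟩ => ⟨z, by rw [hz]; ring⟩, fun ⟨z, hz⟩ => ⟨z, by rw [← hz]; ring⟩⟩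

theorem padicBall_isClopen {p : ℕ} [Fact p.Prime] (a : ℤ_[p]) (l : ℕ) :
    IsClopen (padicBall p a l) := by
  rw [padicBall_eq_closedBall]
  refine IsUltrametricDist.isClopen_closedBall _ ?_
  exact (zpow_pos (by exact_mod_cast (Fact.out : p.Prime).pos) _).ne'

theorem mem_closure_of_forall_pow_dvd {p : ℕ} [Fact p.Prime] {s : Set ℤ_[p]} {y : ℤ_[p]}
    (h : ∀ n : ℕ, ∃ x ∈ s, (p : ℤ_[p]) ^ n ∣ x - y) : y ∈ closure s := by
  rw [Metric.mem_closure_iff]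
  intro ε hε
  obtain ⟨n, hn⟩ := PadicInt.exists_pow_neg_lt p hε
  obtain ⟨x, hx, hd⟩ := h n
  refine ⟨x, hx, lt_of_le_of_lt ?_ hn⟩
  rw [dist_comm, dist_eq_norm, PadicInt.norm_le_pow_iff_mem_span_pow, Ideal.mem_span_singleton]
  exact hd

theorem padicBall_natCast_eq {p : ℕ} [Fact p.Prime] {a b l : ℕ} {x : ℤ_[p]}
    (ha : a < p ^ l) (hb : b < p ^ l) (hxa : x ∈ padicBall p (a : ℤ_[p]) l)
    (hxb : x ∈ padicBall p (b : ℤ_[p]) l) : a = b := by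
  obtain ⟨z, hz⟩ := hxa
  obtain ⟨w, hw⟩ := hxb
  have h : ((p : ℤ) ^ l : ℤ) ∣ (a : ℤ) - b := by
    rw [← PadicInt.pow_p_dvd_int_iff]
    exact ⟨w - z, by push_cast; linear_combination hw - hz⟩
  have h' : a ≡ b [MOD p ^ l] := by
    refine ((Nat.modEq_iff_dvd).2 ?_).symm
    exact_mod_cast h
  exact Nat.ModEq.eq_of_lt_of_lt h' ha hb

theorem exists_mem_padicBall_odd {l : ℕ} {x : ℤ_[2]} (hx : Odd x) :
    ∃ k : ℕ, k < 2 ^ l ∧ x ∈ padicBall 2 (1 + 2 * (k : ℤ_[2])) (l + 1) := by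
  have h := PadicInt.appr_spec (l + 1) x
  have hlt := PadicInt.appr_lt x (l + 1)
  rw [Ideal.mem_span_singleton] at h
  obtain ⟨z, hz⟩ := h
  have hodd : Odd (x.appr (l + 1)) := by
    apply PadicInt.natCast_odd
    have : (x.appr (l + 1) : ℤ_[2]) = x - 2 * (2 ^ l * z) := by
      push_cast at hz
      linear_combination -hz
    rw [this]
    exact hx.sub_even (even_two_mul _)
  obtain ⟨k, hk⟩ := hodd
  rw [hk] at hz hlt
  refine ⟨k, by rw [pow_succ] at hlt; omega, z, ?_⟩
  push_cast at hz ⊢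
  linear_combination hz

end Balls

/-! ### Minimality criterion on balls, and decompositions around a fixed point. -/

section Minimality

theorem IsMinimalOn.eq_closure {α : Type*} [TopologicalSpace α] {f : α → α} {S : Set α}
    (h : IsMinimalOn f S) (hS : IsClosed S) {x : α} (hx : x ∈ S) :
    S = closure (Set.range fun n : ℕ => f^[n] x) := by
  refine (h.2.2 x hx).antisymm (closure_minimal ?_ hS)
  rintro _ ⟨n, rfl⟩
  exact h.2.1.iterate n hx

theorem IsMinimalOn.finite_of_periodic {α : Type*} [TopologicalSpace α] [T1Space α] {f : α → α}
    {S : Set α} (h : IsMinimalOn f S) {x : α} (hx : x ∈ S) (hp : x ∈ Function.periodicPts f) :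
    S.Finite := by
  obtain ⟨n, hn, hpn⟩ := hp
  have hfin : (Set.range fun k : ℕ => f^[k] x).Finite := by
    refine ((Finset.range n).finite_toSet.image fun k => f^[k] x).subset ?_
    rintro _ ⟨k, rfl⟩
    exact ⟨k % n, by simpa using Nat.mod_lt k hn, hpn.iterate_mod_apply k⟩
  have := h.2.2 x hx
  rw [hfin.isClosed.closure_eq] at this
  exact hfin.subset this

theorem IsMinimalComponent.infinite {p : ℕ} [Fact p.Prime] {f : ℤ_[p] → ℤ_[p]} {S : Set ℤ_[p]}
    (h : IsMinimalComponent f S) : S.Infinite := by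
  obtain ⟨T, hT⟩ := h.finite_union_balls
  obtain ⟨x, hx⟩ := h.isMinimalOn.1
  rw [hT] at hx
  simp only [Set.mem_iUnion] at hx
  obtain ⟨b, hb, -⟩ := hx
  refine (padicBall_infinite b.1 b.2).mono ?_
  rw [hT]
  exact Set.subset_biUnion_of_mem (u := fun b : ℤ_[p] × ℕ => padicBall p b.1 b.2) hb

variable {f : ℤ_[2] → ℤ_[2]} {a : ℤ_[2]} {l : ℕ}

theorem mapsTo_padicBall (h1 : ∀ x ∈ padicBall 2 a l, ∃ c, Odd c ∧ f x - x = 2 ^ l * c) :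
    Set.MapsTo f (padicBall 2 a l) (padicBall 2 a l) := by
  intro x hx
  obtain ⟨c, -, hc⟩ := h1 x hx
  obtain ⟨z, hz⟩ := hx
  refine ⟨z + c, ?_⟩
  push_cast at hz ⊢
  linear_combination hc + hz

theorem iterate_sub_iterate (hm : Set.MapsTo f (padicBall 2 a l) (padicBall 2 a l))
    (h2 : ∀ x ∈ padicBall 2 a l, ∀ y ∈ padicBall 2 a l, ∃ t, f x - f y = (x - y) * (1 + 4 * t))
    {x y : ℤ_[2]} (hx : x ∈ padicBall 2 a l) (hy : y ∈ padicBall 2 a l) (n : ℕ) :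
    ∃ t, f^[n] x - f^[n] y = (x - y) * (1 + 4 * t) := by
  induction n with
  | zero => exact ⟨0, by simp⟩
  | succ n ih =>
    obtain ⟨t, ht⟩ := ih
    obtain ⟨s, hs⟩ := h2 _ (hm.iterate n hx) _ (hm.iterate n hy)
    refine ⟨s + t + 4 * s * t, ?_⟩
    rw [Function.iterate_succ_apply', Function.iterate_succ_apply', hs, ht]
    ring

/-- With g = f^[2^n], g(g x) - x = (g x - x)((1 + 4t) + 1), and 2 + 4t is twice an odd element. -/
theorem iterate_two_pow_sub (h1 : ∀ x ∈ padicBall 2 a l, ∃ c, Odd c ∧ f x - x = 2 ^ l * c)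
    (h2 : ∀ x ∈ padicBall 2 a l, ∀ y ∈ padicBall 2 a l, ∃ t, f x - f y = (x - y) * (1 + 4 * t))
    {x : ℤ_[2]} (hx : x ∈ padicBall 2 a l) (n : ℕ) :
    ∃ c, Odd c ∧ f^[2 ^ n] x - x = 2 ^ (l + n) * c := by
  have hm := mapsTo_padicBall h1
  induction n with
  | zero => simpa using h1 x hx
  | succ n ih =>
    obtain ⟨c, hc, h⟩ := ih
    obtain ⟨t, ht⟩ := iterate_sub_iterate hm h2 (hm.iterate (2 ^ n) hx) hx (2 ^ n)
    refine ⟨c * (2 * t + 1), hc.mul (odd_two_mul_add_one t), ?_⟩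
    rw [pow_succ 2 n, mul_two, Function.iterate_add_apply]
    rw [h] at ht
    linear_combination ht + h

theorem isMinimalOn_padicBall (h1 : ∀ x ∈ padicBall 2 a l, ∃ c, Odd c ∧ f x - x = 2 ^ l * c)
    (h2 : ∀ x ∈ padicBall 2 a l, ∀ y ∈ padicBall 2 a l, ∃ t, f x - f y = (x - y) * (1 + 4 * t)) :
    IsMinimalOn f (padicBall 2 a l) := by
  have hm := mapsTo_padicBall h1
  refine ⟨⟨a, mem_padicBall_self a l⟩, hm, fun x hx y hy => mem_closure_of_forall_pow_dvd ?_⟩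
  -- The orbit matches y one binary digit at a time: if the next digit is wrong, 2^n further
  -- iterations flip it and keep the lower ones.
  have key : ∀ n : ℕ, ∃ k : ℕ, ∃ z, f^[k] x - y = 2 ^ (l + n) * z := by
    intro n
    induction n with
    | zero =>
      obtain ⟨z, hz⟩ := hx
      obtain ⟨w, hw⟩ := hy
      refine ⟨0, z - w, ?_⟩
      push_cast at hz hw
      simp only [Function.iterate_zero, id, add_zero]
      linear_combination hz - hw
    | succ n ih =>
      obtain ⟨k, z, hz⟩ := ih
      rcases PadicInt.even_or_odd z with he | ho
      · obtain ⟨r, rfl⟩ := he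
        exact ⟨k, r, by rw [hz]; ring⟩
      · obtain ⟨c, hc, h⟩ := iterate_two_pow_sub h1 h2 (hm.iterate k hx) n
        obtain ⟨r, hr⟩ := hc.add_odd ho
        refine ⟨2 ^ n + k, r, ?_⟩
        rw [Function.iterate_add_apply]
        linear_combination h + hz + 2 ^ (l + n) * hr
  intro n
  obtain ⟨k, z, hz⟩ := key n
  refine ⟨_, ⟨k, rfl⟩, 2 ^ l * z, ?_⟩
  push_cast
  rw [hz]
  ring

theorem isMinimalComponent_padicBall
    (h1 : ∀ x ∈ padicBall 2 a l, ∃ c, Odd c ∧ f x - x = 2 ^ l * c)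
    (h2 : ∀ x ∈ padicBall 2 a l, ∀ y ∈ padicBall 2 a l, ∃ t, f x - f y = (x - y) * (1 + 4 * t)) :
    IsMinimalComponent f (padicBall 2 a l) where
  isClopen := padicBall_isClopen a l
  finite_union_balls := ⟨{(a, l)}, by simp⟩
  isMinimalOn := isMinimalOn_padicBall h1 h2

/-- Minimal components are infinite, hence contain no periodic point; two that share a point both
equal its orbit closure. -/
theorem isMinimalDecomposition_of_fixedPoint {p : ℕ} [Fact p.Prime] {f : ℤ_[p][X]} {ι : Type*}
    [Countable ι] {M : ι → Set ℤ_[p]} {b : ℤ_[p]} (hb : f.eval b = b)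
    (hcover : ∀ x ≠ b, ∃ i, x ∈ M i) (hbM : ∀ i, b ∉ M i)
    (hdisj : Pairwise (Function.onFun Disjoint M))
    (hmin : ∀ i, IsMinimalComponent (fun x => f.eval x) (M i)) :
    IsMinimalDecomposition f {b} M ∅ where
  cover := by
    refine Set.eq_univ_of_forall fun x => ?_
    by_cases hx : x = b
    · exact .inl (.inl hx)
    · exact .inl (.inr (Set.mem_iUnion.2 (hcover x hx)))
  disjoint_periodic_minimal := by simpa using hbM
  disjoint_periodic_basin := Set.disjoint_empty _
  disjoint_minimal_basin := Set.disjoint_empty _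
  periodic_finite := Set.finite_singleton b
  periodic_eq := by
    refine Set.Subset.antisymm ?_ fun x hx => ?_
    · rintro _ rfl
      exact ⟨1, one_pos, hb⟩
    · by_contra hne
      obtain ⟨i, hi⟩ := hcover x hne
      exact (hmin i).infinite ((hmin i).isMinimalOn.finite_of_periodic hi hx)
  countable := inferInstance
  pairwise_disjoint := hdisj
  minimal := hmin
  minimal_all := by
    intro S hS
    obtain ⟨x, hx⟩ := hS.isMinimalOn.1
    by_cases hxb : x = b
    · subst hxb
      exact absurd (hS.isMinimalOn.finite_of_periodic hx ⟨1, one_pos, hb⟩) hS.infinite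
    · obtain ⟨i, hi⟩ := hcover x hxb
      refine ⟨i, ?_⟩
      rw [hS.isMinimalOn.eq_closure hS.isClopen.1 hx,
        (hmin i).isMinimalOn.eq_closure (hmin i).isClopen.1 hi]
  basin := by simp

end Minimality

/-! ### 2-adic estimates for F_m(x) - x and for differences of values. -/

section FibonacciDynamics

theorem u₁_two_pow_mul {v s : ℕ} (hv : 1 ≤ v) (hs : Odd s) : u₁ (2 ^ v * s) = v := by
  have h : ∀ i, (2 ^ v * s).testBit i = true → v ≤ i := by
    intro i hi
    rw [Nat.testBit_two_pow_mul] at hi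
    simp at hi
    exact hi.1
  have hmem : v ∈ {i : ℕ | 1 ≤ i ∧ (2 ^ v * s).testBit i = true} := by
    refine ⟨hv, ?_⟩
    rw [Nat.testBit_two_pow_mul]
    simpa [Nat.odd_iff] using hs
  exact le_antisymm (Nat.sInf_le hmem) (le_csInf ⟨v, hmem⟩ fun i hi => h i hi.2)

theorem exists_eq_two_pow_u₁_mul {q : ℕ} (hpos : 0 < q) (heven : Even q) :
    1 ≤ u₁ q ∧ ∃ s, Odd s ∧ q = 2 ^ u₁ q * s := by
  obtain ⟨v, s, hs, rfl⟩ := Nat.exists_eq_two_pow_mul_odd hpos.ne'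
  have hv : 1 ≤ v := by
    by_contra h
    obtain rfl : v = 0 := by omega
    rw [pow_zero, one_mul] at heven
    exact Nat.not_even_iff_odd.2 hs heven
  rw [u₁_two_pow_mul hv hs]
  exact ⟨hv, s, hs, rfl⟩

theorem eval_fibPoly_six (x : ℤ_[2]) :
    (fibPoly ℤ_[2] 6).eval x = x * (x ^ 2 + 1) * (x ^ 2 + 3) := by
  rw [fibPoly_six]
  simp
  ring

theorem PadicInt.eight_dvd_sq_sub_one {x : ℤ_[2]} (hx : Odd x) : ∃ r, x ^ 2 = 1 + 8 * r := by
  obtain ⟨k, rfl⟩ := hx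
  have : Even (k * (k + 1)) := by
    rcases PadicInt.even_or_odd k with h | h
    · exact h.mul_right _
    · exact h.add_one.mul_left _
  obtain ⟨r, hr⟩ := this
  exact ⟨r, by linear_combination 4 * hr⟩

theorem eval_fibPoly_six_of_odd {x : ℤ_[2]} (hx : Odd x) :
    ∃ c, Odd c ∧ (fibPoly ℤ_[2] 6).eval x = 8 * c := by
  obtain ⟨r, hr⟩ := PadicInt.eight_dvd_sq_sub_one hx
  refine ⟨x * (2 * (2 * r) + 1) * (2 * r + 1),
    (hx.mul (odd_two_mul_add_one _)).mul (odd_two_mul_add_one _), ?_⟩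
  rw [eval_fibPoly_six, hr]
  ring

theorem eval_fibPoly_six_of_even {x : ℤ_[2]} (hx : Even x) :
    ∃ c, Odd c ∧ (fibPoly ℤ_[2] 6).eval x = x * c := by
  obtain ⟨r, rfl⟩ := hx
  refine ⟨((r + r) ^ 2 + 1) * ((r + r) ^ 2 + 3), ⟨8 * r ^ 4 + 8 * r ^ 2 + 1, by ring⟩, ?_⟩
  rw [eval_fibPoly_six]
  ring

theorem eval_fibPoly_six_mul (x : ℤ_[2]) (v : ℕ) {s : ℕ} (hs : Odd s) :
    (∃ c, Odd c ∧ (fibPoly ℤ_[2] (6 * (2 ^ v * s))).eval x =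
      2 ^ v * (fibPoly ℤ_[2] 6).eval x * c) ∧
      Odd ((fibPoly ℤ_[2] (6 * (2 ^ v * s) + 1)).eval x) := by
  have h0 : Even ((fibPoly ℤ_[2] 6).eval x) ∧ 4 ∣ x * (fibPoly ℤ_[2] 6).eval x := by
    rcases PadicInt.even_or_odd x with hx | hx
    · obtain ⟨c, -, hc⟩ := eval_fibPoly_six_of_even hx
      rw [hc]
      obtain ⟨r, rfl⟩ := hx
      exact ⟨⟨r * c, by ring⟩, ⟨r ^ 2 * c, by ring⟩⟩
    · obtain ⟨c, -, hc⟩ := eval_fibPoly_six_of_odd hx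
      rw [hc]
      exact ⟨⟨4 * c, by ring⟩, ⟨2 * x * c, by ring⟩⟩
  -- If F_7(x) were even along with F_6(x), Cassini would make 1 even.
  have h1 : Odd ((fibPoly ℤ_[2] (6 + 1)).eval x) := by
    have h := congrArg (eval x) (fibPoly_cassini (R := ℤ_[2]) 6)
    simp only [eval_sub, eval_mul, eval_pow, eval_X, eval_neg, eval_one] at h
    refine (PadicInt.even_or_odd _).resolve_left fun he => ?_
    have hone : Odd (1 : ℤ_[2]) := odd_one
    refine PadicInt.not_odd_of_even ?_ hone
    rw [show (1 : ℤ_[2]) = (-1) ^ 6 by norm_num, ← h]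
    exact ((he.pow_of_ne_zero two_ne_zero).sub (h0.1.mul_left _)).sub
      (h0.1.pow_of_ne_zero two_ne_zero)
  obtain ⟨⟨c, hc, h⟩, ho⟩ := eval_fibPoly_two_pow_mul h0.1 h1 h0.2 v
  have he : Even ((fibPoly ℤ_[2] (6 * 2 ^ v)).eval x) := by
    rw [h]
    exact (h0.1.mul_left _).mul_right _
  obtain ⟨⟨d, hd, h'⟩, ho'⟩ := eval_fibPoly_mul he ho hs
  rw [← mul_assoc]
  exact ⟨⟨c * d, hc.mul hd, by rw [h', h]; ring⟩, ho'⟩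

variable {v s : ℕ}

theorem fibPoly_sub_X_factor (q : ℕ) : fibPoly ℤ_[2] (2 + 12 * q) - X =
    fibPoly ℤ_[2] (6 * q) *
      ((X ^ 2 + 2) * fibPoly ℤ_[2] (6 * q + 1) + X * fibPoly ℤ_[2] (6 * q)) := by
  rw [← fibPoly_two_mul_add_two_sub ((by decide : Even 6).mul_right q)]
  congr 2
  ring

theorem eval_fibPoly_sub_self_of_odd (hs : Odd s) {x : ℤ_[2]} (hx : Odd x) :
    ∃ c, Odd c ∧ (fibPoly ℤ_[2] (2 + 12 * (2 ^ v * s))).eval x - x = 2 ^ (v + 3) * c := by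
  have h := congrArg (eval x) (fibPoly_sub_X_factor (2 ^ v * s))
  obtain ⟨⟨c, hc, h0⟩, h1⟩ := eval_fibPoly_six_mul x v hs
  obtain ⟨d, hd, h6⟩ := eval_fibPoly_six_of_odd hx
  simp only [eval_sub, eval_mul, eval_add, eval_pow, eval_X, eval_ofNat] at h
  refine ⟨d * c * ((x ^ 2 + 2) * (fibPoly ℤ_[2] (6 * (2 ^ v * s) + 1)).eval x +
    x * (fibPoly ℤ_[2] (6 * (2 ^ v * s))).eval x), ?_, ?_⟩
  · refine (hd.mul hc).mul ((((hx.pow).add_even even_two).mul h1).add_even (.mul_left ?_ _))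
    rw [h0, h6]
    exact even_iff_two_dvd.2 ⟨2 ^ v * 4 * d * c, by ring⟩
  · rw [h, h0, h6]
    ring

theorem even_lucas_factor {x : ℤ_[2]} (hs : Odd s) (hx : Even x) :
    ∃ c, Odd c ∧ (x ^ 2 + 2) * (fibPoly ℤ_[2] (6 * (2 ^ v * s) + 1)).eval x +
      x * (fibPoly ℤ_[2] (6 * (2 ^ v * s))).eval x = 2 * c := by
  obtain ⟨⟨c, hc, h0⟩, h1⟩ := eval_fibPoly_six_mul x v hs
  obtain ⟨d, hd, h6⟩ := eval_fibPoly_six_of_even hx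
  obtain ⟨r, rfl⟩ := hx
  refine ⟨(2 * r ^ 2 + 1) * (fibPoly ℤ_[2] (6 * (2 ^ v * s) + 1)).eval (r + r) +
    2 * (r ^ 2 * 2 ^ v * d * c), ?_, ?_⟩
  · exact ((odd_two_mul_add_one _).mul h1).add_even (even_two_mul _)
  · rw [h0, h6]
    ring

theorem eval_fibPoly_sub_self_of_even (hs : Odd s) {x : ℤ_[2]} (hx : Even x) :
    ∃ c, Odd c ∧ (fibPoly ℤ_[2] (2 + 12 * (2 ^ v * s))).eval x - x = x * 2 ^ (v + 1) * c := by
  have h := congrArg (eval x) (fibPoly_sub_X_factor (2 ^ v * s))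
  obtain ⟨⟨c, hc, h0⟩, h1⟩ := eval_fibPoly_six_mul x v hs
  obtain ⟨d, hd, h6⟩ := eval_fibPoly_six_of_even hx
  obtain ⟨e, he, hL⟩ := even_lucas_factor (v := v) hs hx
  simp only [eval_sub, eval_mul, eval_add, eval_pow, eval_X, eval_ofNat] at h
  refine ⟨d * c * e, (hd.mul hc).mul he, ?_⟩
  rw [h, hL, h0, h6]
  ring

/-- F_m - X = F_12 · Q · L. Halving the variable costs one factor 2 in differences, so 8 is needed:
F_12(2e + 1) is 8 times a polynomial in e, while F_12(2e) supplies 4 and L the remaining 2. -/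
theorem eval_fibPoly_sub_eval (hv : 1 ≤ v) (hs : Odd s) {x y : ℤ_[2]} (hxy : Even (x - y)) :
    ∃ t, (fibPoly ℤ_[2] (2 + 12 * (2 ^ v * s))).eval x -
      (fibPoly ℤ_[2] (2 + 12 * (2 ^ v * s))).eval y = (x - y) * (1 + 4 * t) := by
  obtain ⟨w, rfl⟩ := Nat.exists_eq_add_of_le hv
  have hfac := fibPoly_sub_X_factor (2 ^ (1 + w) * s)
  have hdvd : fibPoly ℤ_[2] 12 ∣ fibPoly ℤ_[2] (6 * (2 ^ (1 + w) * s)) := by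
    rw [show 6 * (2 ^ (1 + w) * s) = 12 * (2 ^ w * s) by ring]
    exact fibPoly_dvd_mul _ _
  obtain ⟨Q, hQ⟩ := hdvd
  set L : ℤ_[2][X] := (X ^ 2 + 2) * fibPoly ℤ_[2] (6 * (2 ^ (1 + w) * s) + 1) +
    X * fibPoly ℤ_[2] (6 * (2 ^ (1 + w) * s)) with hL
  have hD : ∀ z, (fibPoly ℤ_[2] (2 + 12 * (2 ^ (1 + w) * s))).eval z = z +
      (z ^ 5 + 4 * z ^ 3 + 3 * z) * (z ^ 6 + 6 * z ^ 4 + 9 * z ^ 2 + 2) * (Q * L).eval z := by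
    intro z
    have h := congrArg (eval z) hfac
    rw [hQ, fibPoly_twelve] at h
    simp only [eval_sub, eval_mul, eval_add, eval_pow, eval_X, eval_ofNat] at h ⊢
    linear_combination h
  obtain ⟨S, hS⟩ := sub_dvd_eval_sub x y (Q * L)
  have hyL : Even y → Even ((Q * L).eval y) := by
    intro hy
    obtain ⟨c, -, hc⟩ := even_lucas_factor (v := 1 + w) hs hy
    rw [eval_mul]
    refine Even.mul_left (even_iff_two_dvd.2 ⟨c, ?_⟩) _
    rw [← hc, hL]
    simp only [eval_mul, eval_add, eval_pow, eval_X, eval_ofNat]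
  rw [hD, hD]
  generalize (Q * L).eval x = A at *
  generalize (Q * L).eval y = B at *
  obtain rfl : A = B + (x - y) * S := by linear_combination hS
  obtain ⟨d, hd⟩ := hxy
  obtain rfl : x = y + 2 * d := by linear_combination hd
  have he : ∃ e, y = 2 * e ∨ y = 2 * e + 1 := by
    rcases PadicInt.even_or_odd y with ⟨e, he⟩ | ⟨e, he⟩
    · exact ⟨e, .inl (by rw [he]; ring)⟩
    · exact ⟨e, .inr he⟩
  obtain ⟨e, rfl | rfl⟩ := he
  · obtain ⟨b, rfl⟩ := hyL (even_two_mul e)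
    obtain ⟨h, hh⟩ := sub_dvd_eval_sub (e + d) e ((16 * X ^ 5 + 16 * X ^ 3 + 3 * X) *
      (32 * X ^ 6 + 48 * X ^ 4 + 18 * X ^ 2 + 1) : ℤ_[2][X])
    simp only [eval_mul, eval_add, eval_pow, eval_X, eval_ofNat, eval_one] at hh
    refine ⟨b * h + (16 * (e + d) ^ 5 + 16 * (e + d) ^ 3 + 3 * (e + d)) *
      (32 * (e + d) ^ 6 + 48 * (e + d) ^ 4 + 18 * (e + d) ^ 2 + 1) * S, ?_⟩
    linear_combination 8 * b * hh
  · obtain ⟨h, hh⟩ := sub_dvd_eval_sub (e + d) e ((2 * X + 1) * (2 * X ^ 2 + 2 * X + 1) *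
      (X ^ 2 + X + 1) * ((2 * X + 1) ^ 6 + 6 * (2 * X + 1) ^ 4 + 9 * (2 * X + 1) ^ 2 + 2) :
        ℤ_[2][X])
    simp only [eval_mul, eval_add, eval_pow, eval_X, eval_ofNat, eval_one] at hh
    refine ⟨B * h + 2 * ((2 * (e + d) + 1) * (2 * (e + d) ^ 2 + 2 * (e + d) + 1) *
      ((e + d) ^ 2 + (e + d) + 1) * ((2 * (e + d) + 1) ^ 6 + 6 * (2 * (e + d) + 1) ^ 4 +
        9 * (2 * (e + d) + 1) ^ 2 + 2)) * S, ?_⟩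
    linear_combination 8 * B * hh

/-! ### The balls A_k and M_{n,k}: partition and conclusion. -/

theorem odd_of_mem_padicBall {k l : ℕ} {x : ℤ_[2]}
    (hx : x ∈ padicBall 2 (1 + 2 * (k : ℤ_[2])) (l + 1)) : Odd x := by
  obtain ⟨z, hz⟩ := hx
  refine ⟨k + 2 ^ l * z, ?_⟩
  push_cast at hz
  linear_combination hz

theorem exists_odd_of_mem_padicBall {k n l : ℕ} {x : ℤ_[2]}
    (hx : x ∈ padicBall 2 ((1 + 2 * (k : ℤ_[2])) * 2 ^ n) (n + l + 1)) :
    ∃ c ∈ padicBall 2 (1 + 2 * (k : ℤ_[2])) (l + 1), Odd c ∧ x = 2 ^ n * c := by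
  obtain ⟨z, hz⟩ := hx
  have hc : 1 + 2 * (k : ℤ_[2]) + ((2 : ℕ) : ℤ_[2]) ^ (l + 1) * z ∈
    padicBall 2 (1 + 2 * (k : ℤ_[2])) (l + 1) := ⟨z, rfl⟩
  refine ⟨_, hc, odd_of_mem_padicBall hc, ?_⟩
  rw [hz]
  ring

theorem eq_of_mem_padicBall_odd {j k l : ℕ} (hj : j < 2 ^ l) (hk : k < 2 ^ l) {x : ℤ_[2]}
    (hxj : x ∈ padicBall 2 (1 + 2 * (j : ℤ_[2])) (l + 1))
    (hxk : x ∈ padicBall 2 (1 + 2 * (k : ℤ_[2])) (l + 1)) : j = k := by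
  have := padicBall_natCast_eq (p := 2) (a := 1 + 2 * j) (b := 1 + 2 * k) (l := l + 1) (x := x)
    (by rw [pow_succ]; omega) (by rw [pow_succ]; omega)
    (by push_cast; exact hxj) (by push_cast; exact hxk)
  omega

theorem even_sub_of_mem_padicBall {a x y : ℤ_[2]} {l : ℕ} (hx : x ∈ padicBall 2 a (l + 1))
    (hy : y ∈ padicBall 2 a (l + 1)) : Even (x - y) := by
  obtain ⟨z, rfl⟩ := hx
  obtain ⟨w, rfl⟩ := hy
  refine even_iff_two_dvd.2 ⟨2 ^ l * (z - w), ?_⟩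
  push_cast
  ring

theorem isMinimalDecomposition_fibPoly (hv : 1 ≤ v) (hs : Odd s) :
    IsMinimalDecomposition (p := 2) (fibPoly ℤ_[2] (2 + 12 * (2 ^ v * s)))
      {0}
      (Sum.elim
        (fun k : Fin (2 ^ (v + 2)) => padicBall 2 (1 + 2 * ((k : ℕ) : ℤ_[2])) (v + 3))
        (fun nk : ℕ+ × Fin (2 ^ v) =>
          padicBall 2 ((1 + 2 * ((nk.2 : ℕ) : ℤ_[2])) * 2 ^ (nk.1 : ℕ)) ((nk.1 : ℕ) + v + 1)))
      ∅ := by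
  have heven : ∀ (n : ℕ+) (c : ℤ_[2]), Even (2 ^ (n : ℕ) * c) := fun n c =>
    (even_two.pow_of_ne_zero n.ne_zero).mul_right c
  refine isMinimalDecomposition_of_fixedPoint ?_ ?_ ?_ ?_ ?_
  · obtain ⟨c, -, hc⟩ := eval_fibPoly_sub_self_of_even (v := v) hs (Even.zero (α := ℤ_[2]))
    simpa using hc
  · intro x hx
    obtain ⟨n, c, hc, rfl⟩ := PadicInt.exists_eq_two_pow_mul_odd hx
    -- Valuation 0 leads to some A_k, valuation n ≥ 1 to some M_{n,k}; k comes from the odd part.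
    rcases Nat.eq_zero_or_pos n with rfl | hn
    · obtain ⟨k, hk, hck⟩ := exists_mem_padicBall_odd (l := v + 2) hc
      exact ⟨.inl ⟨k, hk⟩, by simpa using hck⟩
    · obtain ⟨k, hk, z, hz⟩ := exists_mem_padicBall_odd (l := v) hc
      refine ⟨.inr (⟨n, hn⟩, ⟨k, hk⟩), z, ?_⟩
      simp only [PNat.mk_coe]
      rw [hz]
      push_cast
      ring
  · rintro (k | ⟨n, k⟩) h
    · exact PadicInt.not_odd_of_even Even.zero (odd_of_mem_padicBall h)
    · obtain ⟨c, -, hc, h0⟩ := exists_odd_of_mem_padicBall h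
      have : c = 0 := by simpa using h0.symm
      exact PadicInt.not_odd_of_even Even.zero (this ▸ hc)
  · rintro (j | ⟨n, j⟩) (k | ⟨n', k⟩) hne <;> refine Set.disjoint_left.2 fun x hx hy => ?_
    · exact hne (congrArg _ (Fin.ext (eq_of_mem_padicBall_odd j.2 k.2 hx hy)))
    · obtain ⟨c, -, -, rfl⟩ := exists_odd_of_mem_padicBall hy
      exact PadicInt.not_odd_of_even (heven n' c) (odd_of_mem_padicBall hx)
    · obtain ⟨c, -, -, rfl⟩ := exists_odd_of_mem_padicBall hx
      exact PadicInt.not_odd_of_even (heven n c) (odd_of_mem_padicBall hy)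
    · obtain ⟨c, hcj, hc, rfl⟩ := exists_odd_of_mem_padicBall hx
      obtain ⟨d, hdk, hd, h⟩ := exists_odd_of_mem_padicBall hy
      obtain rfl : n = n' := PNat.coe_injective (PadicInt.two_pow_mul_odd_inj hc hd h)
      obtain rfl : c = d := mul_left_cancel₀ (pow_ne_zero _ two_ne_zero) h
      exact hne (congrArg (fun i => Sum.inr (n, i))
        (Fin.ext (eq_of_mem_padicBall_odd j.2 k.2 hcj hdk)))
  · rintro (k | ⟨n, k⟩)
    · exact isMinimalComponent_padicBall
        (fun x hx => eval_fibPoly_sub_self_of_odd hs (odd_of_mem_padicBall hx))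
        (fun x hx y hy => eval_fibPoly_sub_eval hv hs (even_sub_of_mem_padicBall hx hy))
    · refine isMinimalComponent_padicBall (fun x hx => ?_)
        (fun x hx y hy => eval_fibPoly_sub_eval hv hs (even_sub_of_mem_padicBall hx hy))
      obtain ⟨c, -, hc, rfl⟩ := exists_odd_of_mem_padicBall hx
      obtain ⟨d, hd, h⟩ := eval_fibPoly_sub_self_of_even (v := v) hs (heven n c)
      refine ⟨c * d, hc.mul hd, ?_⟩
      simp only [h]
      ring

end FibonacciDynamics

theorem mainTheorem4 (q m u : ℕ) (hq_pos : 0 < q) (hq_even : Even q)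
    (hm : m = 2 + 12 * q) (hu : u = u₁ q) :
    (fibPoly ℤ_[2] m).eval 0 = 0 ∧
    IsMinimalDecomposition (p := 2) (fibPoly ℤ_[2] m)
      {0}
      (Sum.elim
        (fun k : Fin (2 ^ (u + 2)) => padicBall 2 (1 + 2 * ((k : ℕ) : ℤ_[2])) (u + 3))
        (fun nk : ℕ+ × Fin (2 ^ u) =>
          padicBall 2 ((1 + 2 * ((nk.2 : ℕ) : ℤ_[2])) * 2 ^ (nk.1 : ℕ)) ((nk.1 : ℕ) + u + 1)))
      ∅ := by
  obtain ⟨hv, s, hs, hqs⟩ := exists_eq_two_pow_u₁_mul hq_pos hq_even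
  rw [← hu] at hv hqs
  subst hm
  rw [hqs]
  refine ⟨?_, isMinimalDecomposition_fibPoly hv hs⟩
  obtain ⟨c, -, hc⟩ := eval_fibPoly_sub_self_of_even (v := u) hs (Even.zero (α := ℤ_[2]))
  simpa using hc
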